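/- For $x\ge 0$ let $\mathrm{twr}(x)=t_{\lceil x\rceil}$, where $t_0=1$ and $t_{h+1}=2^{t_h}$. For a finite simple graph $G$ and vertex sets $A,B$ let $d_G(A,B)=e(A,B)/(|A||B|)$, where $e(A,B)$ is the number of pairs $(x,y)\in A\times B$ with $xy$ an edge of $G$. The pair $(A,B)$ is $\epsilon$-regular if $|d_G(A,B)-d_G(A',B')|\le\epsilon$ for all $A'\subseteq A$, $B'\subseteq B$ with $|A'|\ge\epsilon|A|$ and $|B'|\ge\epsilon|B|$. A partition $\{Z_1,\dots,Z_k\}$ of the vertex set (into non-empty sets) is an $\epsilon$-regular equipartition of order $k$ if the sizes of any two $Z_i$ differ by at most $1$ and all but at most $\epsilon k^2$ of the $k^2$ ordered pairs $(Z_i,Z_j)$ (with $i=j$ allowed) are $\epsilon$-regular. **Theorem.** There is an absolute constant $c>0$ such that for every $0<\epsilon<c$ there is a finite graph $G$ all of whose $\epsilon$-regular equipartitions have order at least $\mathrm{twr}(c/\epsilon^{1/6})$. In particular, if $M$ is such that every finite graph has an $\epsilon$-regular equipartition of order at most $M$, then $M\ge\mathrm{twr}(c/\epsilon^{1/6})$;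 that is, the optimal bound $M(\epsilon)$ in Szemerédi's regularity lemma satisfies $M(\epsilon)\ge\mathrm{twr}(\Omega(\epsilon^{-1/6}))$. -/

import Mathlib

namespace TowerBound

/-- The tower of exponents `2 ^ 2 ^ ⋯ ^ 2` of integer height `h`. -/
def tower : ℕ → ℕ
  | 0 => 1
  | h + 1 => 2 ^ tower h

/-- `twr x`, the tower of exponents of real height `x`, the height being rounded up. -/
noncomputable def twr (x : ℝ) : ℕ :=
  tower ⌈x⌉₊

open Classical in
/-- The pair `(A, B)` is `ε`-regular in `G`: all `A' ⊆ A` and `B' ⊆ B` with `|A'| ≥ ε|A|` and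
`|B'| ≥ ε|B|` satisfy `|d_G(A, B) - d_G(A', B')| ≤ ε`. Here `G.edgeDensity A B` is the number of
`(x, y) ∈ A × B` with `x` adjacent to `y`, divided by `|A||B|`; `A` and `B` may intersect. -/
def IsRegularPair {V : Type*} (G : SimpleGraph V) (ε : ℝ) (A B : Finset V) : Prop :=
  ∀ A' ⊆ A, ∀ B' ⊆ B, ε * (A.card : ℝ) ≤ (A'.card : ℝ) → ε * (B.card : ℝ) ≤ (B'.card : ℝ) →
    |(G.edgeDensity A B : ℝ) - (G.edgeDensity A' B' : ℝ)| ≤ ε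

open Classical in
/-- The ordered pairs of parts of `P`, not necessarily distinct, that are not `ε`-regular. -/
noncomputable def irregularPairs {V : Type*} [Fintype V] [DecidableEq V] (G : SimpleGraph V)
    (ε : ℝ) (P : Finpartition (Finset.univ : Finset V)) : Finset (Finset V × Finset V) :=
  (P.parts ×ˢ P.parts).filter fun Z => ¬ IsRegularPair G ε Z.1 Z.2

/-- `P` is an `ε`-regular equipartition of `G`: the sizes of its parts differ by at most one, and
all but at most `ε k²` of the `k²` pairs of parts are `ε`-regular, `k` being the order of `P`. -/
def IsRegularEquipartition {V : Type*} [Fintype V] [DecidableEq V] (G : SimpleGraph V)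
    (ε : ℝ) (P : Finpartition (Finset.univ : Finset V)) : Prop :=
  P.IsEquipartition ∧ ((irregularPairs G ε P).card : ℝ) ≤ ε * (P.parts.card : ℝ) ^ 2

/-- `M` is an upper bound in the regularity lemma for `ε`: every finite graph has an `ε`-regular
equipartition of order at most `M`. -/
def IsRegularityBound (ε : ℝ) (M : ℕ) : Prop :=
  ∀ (n : ℕ) (G : SimpleGraph (Fin n)),
    ∃ P : Finpartition (Finset.univ : Finset (Fin n)),
      IsRegularEquipartition G ε P ∧ P.parts.card ≤ M

end TowerBound

namespace TowerBound

open Finset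

/-! Write n for the number of vertices. The graph carries a chain of equipartitions with `s`
refinement steps, each exponentially finer than the one before. A vertex has a sign towards every
part of level `r`, and its sign vector (a code word) determines its part of level `r + 1` within its
part of level `r`. As codes on N coordinates have exponentially many words, the finest partition has
tower many parts (`exists_code`, `Hierarchy.exists_large`).

Two vertices are adjacent when their signs towards each other differ, at a level given by labels in
ℤ/s; thus every vertex meets each level on a 1/s fraction of the labels. If `x`, `x'` share a part
of level `r` but have opposite signs towards a part C, then half of C is seen entirely by `x` and
not at all by `x'` at level `r`, while all other levels contribute equally. This gives a degree gap
of |C|/(2s) (`Hierarchy.degree_gap`).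

Every ε-regular equipartition must then almost refine every level (`LayeredGraph.inside_succ`). If Z
lies almost in a part of level `r` but is spread over level `r + 1`, separation of the code makes a
positive proportion of signs split Z into two substantial pieces (`card_le_card_splitting`). The
resulting gaps must be absorbed by the other parts; those regular with Z and almost inside level `r`
absorb little, and the rest have small total size. The error grows by 8ε per level, so ε s² below a
constant suffices to reach level `s`. Hence heights of order ε^(-1/2) are attained, more than the
ε^(-1/6) required. -/

/-! ### Codes of exponential size. -/

open Classical in
/-- The number of sign vectors at normalised Hamming distance at most `1/4` from a fixed one. -/
theorem card_hammingBall_le {V : Type*} [Fintype V] (c : V → Bool) :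
    (#{x : V → Bool | 4 * #{j | x j ≠ c j} ≤ Fintype.card V} : ℝ) ≤
      (337 / 192 : ℝ) ^ Fintype.card V := by
  -- Exponential moment bound: the weights make a vector weigh at least 1 once agreements are at
  -- least three times the disagreements, and each coordinate has total weight 4/3 + 27/64 =
  -- 337/192.
  have hprod : ∑ x : V → Bool, ∏ j, (if x j = c j then (4 / 3 : ℝ) else (3 / 4) ^ 3) =
      (337 / 192 : ℝ) ^ Fintype.card V := by
    have h := Finset.prod_univ_sum (fun _ : V => (univ : Finset Bool))
      (fun j b => if b = c j then (4 / 3 : ℝ) else (3 / 4) ^ 3)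
    rw [Fintype.piFinset_univ] at h
    rw [← h, ← Finset.card_univ, ← Finset.prod_const]
    refine Finset.prod_congr rfl fun j _ => ?_
    rw [Fintype.sum_bool]
    cases c j <;> norm_num
  rw [← hprod, Finset.card_eq_sum_ones, Nat.cast_sum, Finset.sum_filter]
  refine Finset.sum_le_sum fun x _ => ?_
  split_ifs with hx
  · rw [Finset.prod_ite, Finset.prod_const, Finset.prod_const]
    have hcard := Finset.card_filter_add_card_filter_not (s := univ) (fun j => x j = c j)
    rw [Finset.card_univ] at hcard
    simp only [ne_eq] at hx
    set a := #{j | x j = c j}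
    set b := #{j | ¬ x j = c j}
    have hab : 3 * b ≤ a := by omega
    calc ((1 : ℕ) : ℝ) = (4 / 3 : ℝ) ^ (3 * b) * ((3 / 4) ^ 3) ^ b := by
          rw [pow_mul, ← mul_pow]; norm_num
      _ ≤ _ := by
          gcongr
          norm_num
  · exact Finset.prod_nonneg fun j _ => by split_ifs <;> positivity

open Classical in
/-- An exponentially large family of sign vectors, closed under negation, with all pairwise
distances at least a quarter of the length. -/
theorem exists_code (V : Type*) [Fintype V] :
    ∃ K : Finset (V → Bool), (∀ c ∈ K, (fun j => !c j) ∈ K) ∧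
      (∀ c ∈ K, ∀ d ∈ K, c ≠ d → Fintype.card V ≤ 4 * #{j | c j ≠ d j}) ∧
      (384 / 337 : ℝ) ^ Fintype.card V ≤ #K := by
  let S : Set (Finset (V → Bool)) := {K | (∀ c ∈ K, (fun j => !c j) ∈ K) ∧
      ∀ c ∈ K, ∀ d ∈ K, c ≠ d → Fintype.card V ≤ 4 * #{j | c j ≠ d j}}
  obtain ⟨K, hK⟩ := (Set.toFinite S).exists_maximal ⟨∅, by simp [S]⟩
  refine ⟨K, hK.prop.1, hK.prop.2, ?_⟩
  -- By maximality the balls around `K` cover the cube: an uncovered `x` could be adjoined together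
  -- with its negation. Hence |K| ≥ (2 / (337/192))^|V|.
  have hcover : ∀ x : V → Bool, ∃ c ∈ K, 4 * #{j | x j ≠ c j} ≤ Fintype.card V := by
    intro x
    by_contra! hx
    have hxK : x ∉ K := fun h => by simpa using hx x h
    have hx' : ∀ c ∈ K, Fintype.card V < 4 * #{j | (!x j) ≠ c j} := by
      intro c hc
      have heq : ∀ j, ((!x j) ≠ c j) = (x j ≠ !c j) := fun j => by
        cases x j <;> cases c j <;> simp
      simp only [heq]
      exact hx _ (hK.prop.1 c hc)
    have hself : Fintype.card V ≤ 4 * #{j | x j ≠ !x j} := by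
      have : #{j | x j ≠ !x j} = Fintype.card V := by simp
      omega
    have hsymm : ∀ a b : V → Bool, #{j | a j ≠ b j} = #{j | b j ≠ a j} := by
      intro a b; simp only [ne_comm]
    have hmem : insert x (insert (fun j => !x j) K) ∈ S := by
      refine ⟨?_, ?_⟩
      · intro c hc
        simp only [mem_insert] at hc ⊢
        rcases hc with rfl | rfl | hc
        · exact Or.inr (Or.inl rfl)
        · left; funext j; simp
        · exact Or.inr (Or.inr (hK.prop.1 c hc))
      · intro c hc d hd hcd
        simp only [mem_insert] at hc hd
        rcases hc with rfl | rfl | hc <;> rcases hd with rfl | rfl | hd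
        · exact absurd rfl hcd
        · exact hself
        · exact (hx d hd).le
        · rw [hsymm]; exact hself
        · exact absurd rfl hcd
        · exact (hx' d hd).le
        · rw [hsymm]; exact (hx c hc).le
        · rw [hsymm]; exact (hx' c hc).le
        · exact hK.prop.2 c hc d hd hcd
    have := hK.le_of_ge hmem (fun c hc => mem_insert_of_mem (mem_insert_of_mem hc))
    exact hxK (this (mem_insert_self _ _))
  have hcount : (2 : ℝ) ^ Fintype.card V ≤ #K * (337 / 192 : ℝ) ^ Fintype.card V := by
    have h1 : (univ : Finset (V → Bool)) ⊆
        K.biUnion fun c => {x | 4 * #{j | x j ≠ c j} ≤ Fintype.card V} := by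
      intro x _
      simpa using hcover x
    have h2 := (Finset.card_le_card h1).trans Finset.card_biUnion_le
    rw [Finset.card_univ, Fintype.card_fun, Fintype.card_bool] at h2
    calc (2 : ℝ) ^ Fintype.card V
        ≤ ((∑ c ∈ K, #{x : V → Bool | 4 * #{j | x j ≠ c j} ≤ Fintype.card V} : ℕ) : ℝ) := by
          exact_mod_cast h2
      _ ≤ ∑ c ∈ K, (337 / 192 : ℝ) ^ Fintype.card V := by
          rw [Nat.cast_sum]
          exact Finset.sum_le_sum fun c _ => card_hammingBall_le c
      _ = _ := by rw [Finset.sum_const, nsmul_eq_mul]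
  have h3 : (384 / 337 : ℝ) ^ Fintype.card V * (337 / 192 : ℝ) ^ Fintype.card V =
      2 ^ Fintype.card V := by rw [← mul_pow]; norm_num
  rw [← h3] at hcount
  exact le_of_mul_le_mul_right hcount (by positivity)

/-! ### Hierarchies of tower size. -/

open Classical in
/-- A chain of `s + 1` successively finer equipartitions of `V`, from the trivial one to the
discrete one. At level `r < s` every vertex has a sign towards every part of level `r`, depending
only on its part of level `r + 1`; the signs are balanced in each part of level `r`, and distinct
parts of level `r + 1` have signs that differ towards a quarter of `V`. -/
structure Hierarchy (V : Type*) [Fintype V] (s : ℕ) where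
  cell : ℕ → Setoid V
  sign : ℕ → V → V → Bool
  flip : ℕ → V → V
  size : ℕ → ℕ
  cell_zero : cell 0 = ⊤
  cell_last : cell s = ⊥
  cell_anti : Antitone cell
  card_cell : ∀ r x, #{z | cell r x z} = size r
  sign_congr_left : ∀ r < s, ∀ x x' y, cell (r + 1) x x' → sign r x y = sign r x' y
  sign_congr_right : ∀ r < s, ∀ x y y', cell r y y' → sign r x y = sign r x y'
  flip_flip : ∀ r < s, ∀ x, flip r (flip r x) = x
  cell_flip : ∀ r < s, ∀ x, cell r x (flip r x)
  sign_flip : ∀ r < s, ∀ x y, sign r (flip r x) y = !sign r x y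
  separated : ∀ r < s, ∀ x x', cell r x x' → ¬ cell (r + 1) x x' →
    Fintype.card V ≤ 4 * #{y | sign r x y ≠ sign r x' y}

namespace Hierarchy

open Classical in
/-- The hierarchy of height zero on a single vertex. -/
noncomputable def unit : Hierarchy Unit 0 where
  cell _ := ⊤
  sign _ _ _ := true
  flip _ x := x
  size _ := 1
  cell_zero := rfl
  cell_last := by ext x y; exact ⟨fun _ => Subsingleton.elim _ _, fun _ => trivial⟩
  cell_anti := antitone_const
  card_cell _ x := by
    rw [Finset.card_eq_one]
    exact ⟨x, by ext y; exact ⟨fun _ => mem_singleton.2 (Subsingleton.elim _ _),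
      fun _ => mem_filter.2 ⟨mem_univ _, trivial⟩⟩⟩
  sign_congr_left := by simp
  sign_congr_right := by simp
  flip_flip := by simp
  cell_flip := by simp
  sign_flip := by simp
  separated := by simp

open Classical in
/-- Splitting every vertex of a hierarchy into the elements of a code of sign vectors. -/
noncomputable def succ {V : Type*} [Fintype V] {s : ℕ} (H : Hierarchy V s)
    (K : Finset (V → Bool)) (hneg : ∀ c ∈ K, (fun j => !c j) ∈ K)
    (hK : ∀ c ∈ K, ∀ d ∈ K, c ≠ d → Fintype.card V ≤ 4 * #{j | c j ≠ d j}) :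
    Hierarchy (V × K) (s + 1) where
  cell r := if r ≤ s then (H.cell r).comap Prod.fst else ⊥
  -- Level `s` was discrete on `V`, so a code word is exactly a sign towards every part of that
  -- level. Closure of `K` under negation provides the new `flip`.
  sign r x y := if r < s then H.sign r x.1 y.1 else x.2.1 y.1
  flip r x := if r < s then (H.flip r x.1, x.2) else (x.1, ⟨fun j => !x.2.1 j, hneg _ x.2.2⟩)
  size r := if r ≤ s then H.size r * #K else 1
  cell_zero := by
    rw [if_pos (Nat.zero_le s), H.cell_zero]
    rfl
  cell_last := by simp
  cell_anti := by
    intro a b hab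
    dsimp only
    split_ifs with h1 h2
    · intro x y h
      exact H.cell_anti hab h
    · omega
    · exact bot_le
    · exact bot_le
  card_cell r x := by
    by_cases h : r ≤ s
    · rw [if_pos h, if_pos h, ← H.card_cell r x.1, ← Fintype.card_coe K, ← Finset.card_univ,
        ← Finset.card_product]
      congr 1
      ext ⟨y, c⟩
      rw [mem_filter, mem_product, mem_filter]
      simp [Setoid.comap_rel]
    · rw [if_neg h, if_neg h, Finset.card_eq_one]
      refine ⟨x, ?_⟩
      ext y
      rw [mem_filter, mem_singleton]
      exact ⟨fun hy => hy.2.symm, fun hy => ⟨mem_univ _, hy.symm⟩⟩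
  sign_congr_left r hr x x' y h := by
    split_ifs with h1
    · rw [if_pos (by omega)] at h
      exact H.sign_congr_left r h1 _ _ _ h
    · rw [if_neg (by omega)] at h
      obtain rfl : x = x' := h
      rfl
  sign_congr_right r hr x y y' h := by
    rw [if_pos (by omega)] at h
    split_ifs with h1
    · exact H.sign_congr_right r h1 _ _ _ h
    · obtain rfl : r = s := by omega
      rw [H.cell_last] at h
      have h : y.1 = y'.1 := h
      rw [h]
  flip_flip r hr x := by
    split_ifs with h1
    · simp [H.flip_flip r h1]
    · simp
  cell_flip r hr x := by
    rw [if_pos (by omega)]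
    split_ifs with h1
    · exact H.cell_flip r h1 x.1
    · exact (H.cell r).refl _
  sign_flip r hr x y := by
    split_ifs with h1
    · exact H.sign_flip r h1 _ _
    · rfl
  separated r hr x x' h h' := by
    rw [if_pos (by omega)] at h
    have key : ∀ (p : V → Prop) [DecidablePred p], Fintype.card V ≤ 4 * #{y | p y} →
        Fintype.card (V × K) ≤ 4 * #{y : V × K | p y.1} := by
      intro p _ hp
      have : #{y : V × K | p y.1} = #{y | p y} * Fintype.card K := by
        rw [← Finset.card_univ (α := K), ← Finset.card_product]
        congr 1
        ext ⟨y, c⟩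
        simp
      rw [this, Fintype.card_prod, ← mul_assoc]
      exact Nat.mul_le_mul_right _ hp
    split_ifs with h1
    · rw [if_pos (by omega)] at h'
      exact key (fun y => H.sign r x.1 y ≠ H.sign r x'.1 y) (H.separated r h1 _ _ h h')
    · rw [if_neg (by omega)] at h'
      obtain rfl : r = s := by omega
      rw [H.cell_last] at h
      have h : x.1 = x'.1 := h
      refine key (fun y => x.2.1 y ≠ x'.2.1 y) (hK _ x.2.2 _ x'.2.2 fun h2 => h' ?_)
      exact Prod.ext h (Subtype.ext h2)

/-- Hierarchies of height `s` on sets of tower size exist. -/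
theorem exists_large (s : ℕ) :
    ∃ (V : Type) (_ : Fintype V) (_ : Hierarchy V s), 2 ^ s ≤ Fintype.card V ∧
      ∀ h, h + 3 ≤ s → 8 * tower h ≤ Fintype.card V := by
  classical
  induction s with
  | zero => exact ⟨Unit, inferInstance, unit, by simp, by simp⟩
  | succ s ih =>
    obtain ⟨V, _, H, hV, hT⟩ := ih
    obtain ⟨K, hneg, hK, hcard⟩ := exists_code V
    have hVpos : 0 < Fintype.card V := lt_of_lt_of_le (by positivity) hV
    have hK2 : 2 ≤ #K := by
      have : (1 : ℝ) < #K := lt_of_lt_of_le (one_lt_pow₀ (by norm_num) hVpos.ne') hcard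
      exact_mod_cast this
    have hcardV : Fintype.card (V × K) = Fintype.card V * #K := by
      rw [Fintype.card_prod, Fintype.card_coe]
    have h2 : 2 ^ (s + 1) ≤ Fintype.card (V × K) := by
      rw [hcardV, pow_succ]
      exact Nat.mul_le_mul hV hK2
    refine ⟨V × K, inferInstance, H.succ K hneg hK, h2, ?_⟩
    intro h hs
    cases h with
    | zero =>
      refine le_trans ?_ h2
      -- The delay of three levels buys the factor 8, which is needed because (384/337)^8 ≥ 2.
      calc 8 * tower 0 = 2 ^ 3 := rfl
        _ ≤ 2 ^ (s + 1) := Nat.pow_le_pow_right (by norm_num) (by omega)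
    | succ h =>
      have hV8 := hT h (by omega)
      have htpos : 1 ≤ tower h := by
        cases h with
        | zero => exact le_rfl
        | succ h => exact Nat.one_le_two_pow
      have hKt : 2 ^ tower h ≤ #K := by
        have : (2 : ℝ) ^ tower h ≤ #K := by
          calc (2 : ℝ) ^ tower h ≤ ((384 / 337 : ℝ) ^ 8) ^ tower h := by gcongr; norm_num
            _ = (384 / 337 : ℝ) ^ (8 * tower h) := by rw [pow_mul]
            _ ≤ (384 / 337 : ℝ) ^ Fintype.card V := pow_le_pow_right₀ (by norm_num) hV8
            _ ≤ #K := hcard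
        exact_mod_cast this
      rw [hcardV]
      exact Nat.mul_le_mul (by omega) hKt

end Hierarchy

/-! ### The layered graph and its degree gaps. -/

open Classical in
/-- A chain of equipartitions of the vertices of `G` with signs as in `Hierarchy`, such that two
vertices in a common part of level `r < s` with opposite signs towards a part `C` of level `r` have
quite different degrees into a certain subset of `C`. -/
structure LayeredGraph {W : Type*} [Fintype W] (G : SimpleGraph W) (s : ℕ) where
  cell : ℕ → Setoid W
  sign : ℕ → W → W → Bool
  size : ℕ → ℕ
  cell_zero : cell 0 = ⊤
  card_cell : ∀ r x, #{z | cell r x z} = size r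
  sign_congr_left : ∀ r < s, ∀ x x' y, cell (r + 1) x x' → sign r x y = sign r x' y
  separated : ∀ r < s, ∀ x x', cell r x x' → ¬ cell (r + 1) x x' →
    Fintype.card W ≤ 4 * #{y | sign r x y ≠ sign r x' y}
  degree_gap : ∀ r < s, ∀ x₀ x x' y, cell r x₀ x → cell r x₀ x' →
    sign r x y = false → sign r x' y = true →
    2 * s * #{z | (cell r y z ∧ sign r z x₀ = true) ∧ G.Adj x' z} + size r ≤
      2 * s * #{z | (cell r y z ∧ sign r z x₀ = true) ∧ G.Adj x z}

theorem two_mul_card_filter_of_involution {V : Type*} {f : V → V} {U : Finset V} {p : V → Prop}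
    [DecidablePred p] (hf : ∀ z, f (f z) = z) (hU : ∀ z ∈ U, f z ∈ U)
    (hp : ∀ z ∈ U, (p (f z) ↔ ¬ p z)) : 2 * #{z ∈ U | p z} = #U := by
  have h : #{z ∈ U | p z} = #{z ∈ U | ¬ p z} := by
    refine Finset.card_nbij' f f ?_ ?_ (fun z _ => hf z) (fun z _ => hf z)
    · intro z hz
      simp only [coe_filter, Set.mem_ofPred_eq] at hz ⊢
      exact ⟨hU z hz.1, fun h => (hp z hz.1).1 h hz.2⟩
    · intro z hz
      simp only [coe_filter, Set.mem_ofPred_eq] at hz ⊢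
      exact ⟨hU z hz.1, (hp z hz.1).2 hz.2⟩
  rw [← Finset.card_filter_add_card_filter_not (s := U) p, ← h, two_mul]

-- This is the purpose of the factor ℤ/s: for fixed `a` the label `a + b` runs through every level
-- exactly once, so a degree becomes a sum over levels.
open Classical in
theorem card_filter_add_val {V : Type*} [Fintype V] {s : ℕ} [NeZero s] (a : ZMod s)
    (Q : ℕ → V → Prop) :
    #{p : V × ZMod s | Q (a + p.2).val p.1} = ∑ q ∈ range s, #{z | Q q z} := by
  rw [Finset.card_filter, Fintype.sum_prod_type_right,
    Fintype.sum_equiv (Equiv.addLeft a) _ (fun b : ZMod s => #{z | Q b.val z}) fun b => by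
      rw [Finset.card_filter]; rfl]
  refine Finset.sum_nbij ZMod.val (fun b _ => mem_range.2 (ZMod.val_lt b))
    (ZMod.val_injective s).injOn (fun q hq => ?_) (fun _ _ => rfl)
  exact ⟨(q : ZMod s), mem_coe.2 (mem_univ _), ZMod.val_cast_of_lt (mem_range.1 (mem_coe.1 hq))⟩

namespace Hierarchy

variable {V : Type*} [Fintype V] {s : ℕ}

open Classical in
theorem two_mul_card_sign (H : Hierarchy V s) {r : ℕ} (hr : r < s) (x y : V) :
    2 * #{z | H.cell r y z ∧ H.sign r z x = true} = H.size r := by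
  rw [← H.card_cell r y, ← Finset.filter_filter]
  refine two_mul_card_filter_of_involution (H.flip_flip r hr) ?_ ?_
  · intro z hz
    simp only [mem_filter, mem_univ, true_and] at hz ⊢
    exact (H.cell r).trans hz (H.cell_flip r hr z)
  · intro z _
    rw [H.sign_flip r hr]
    simp

open Classical in
/-- Finer levels contribute to degrees as if they were random. -/
theorem two_mul_card_sign_ne (H : Hierarchy V s) {r q : ℕ} (hrq : r < q) (hq : q < s)
    (x₀ x y : V) :
    2 * #{z | (H.cell r y z ∧ H.sign r z x₀ = true) ∧ H.sign q x z ≠ H.sign q z x} =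
      #{z | H.cell r y z ∧ H.sign r z x₀ = true} := by
  -- The flip at level `q` moves `z` within its part of level `q`, so it keeps the sign of `x`
  -- towards `z`; it also keeps the part of level `r + 1`, hence the sign of `z` at level `r`. Only
  -- the sign of `z` towards `x` is reversed.
  rw [← Finset.filter_filter]
  refine two_mul_card_filter_of_involution (H.flip_flip q hq) ?_ ?_
  · intro z hz
    simp only [mem_filter, mem_univ, true_and] at hz ⊢
    have hc := H.cell_flip q hq z
    refine ⟨(H.cell r).trans hz.1 (H.cell_anti hrq.le hc), ?_⟩
    rw [← hz.2]
    exact (H.sign_congr_left r (hrq.trans hq) _ _ _ (H.cell_anti hrq hc)).symm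
  · intro z _
    rw [H.sign_flip q hq, H.sign_congr_right q hq x _ _ ((H.cell q).symm (H.cell_flip q hq z))]
    cases H.sign q x z <;> cases H.sign q z x <;> simp

/-- The graph on `V × ℤ/s` (up to a relabelling) in which `(x, a)` and `(y, b)` are adjacent if the
signs of `x` and `y` towards each other differ at level `a + b`. -/
def graph (H : Hierarchy V s) {W : Type*} (e : W ≃ V × ZMod s) : SimpleGraph W where
  Adj x y := H.sign ((e x).2 + (e y).2).val (e x).1 (e y).1 ≠
    H.sign ((e x).2 + (e y).2).val (e y).1 (e x).1
  symm := ⟨fun x y h => by rw [add_comm]; exact h.symm⟩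
  loopless := ⟨fun x h => h rfl⟩

open Classical in
theorem card_filter_equiv [NeZero s] {W : Type*} [Fintype W] (e : W ≃ V × ZMod s)
    (p : V × ZMod s → Prop) : #{w | p (e w)} = #{v | p v} :=
  Finset.card_equiv e fun w => by simp

open Classical in
theorem card_filter_equiv_fst [NeZero s] {W : Type*} [Fintype W] (e : W ≃ V × ZMod s)
    (p : V → Prop) : #{w | p (e w).1} = #{v | p v} * s := by
  rw [card_filter_equiv e fun v => p v.1]
  conv_rhs => rw [← ZMod.card s, ← Finset.card_univ (α := ZMod s), ← Finset.card_product]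
  congr 1
  ext ⟨v, a⟩
  simp

-- At level `r`, `x` meets the whole test set and `x'` none of it. Coarser levels do not distinguish
-- `x` from `x'`, and at each finer level both meet exactly half. The difference is therefore the
-- size of the test set, half a part.
open Classical in
theorem degree_gap (H : Hierarchy V s) {r : ℕ} (hr : r < s) {x₀ x x' y : V}
    (hx : H.cell r x₀ x) (hx' : H.cell r x₀ x') (hxy : H.sign r x y = false)
    (hxy' : H.sign r x' y = true) :
    2 * ∑ q ∈ range s, #{z | (H.cell r y z ∧ H.sign r z x₀ = true) ∧
        H.sign q x' z ≠ H.sign q z x'} + H.size r =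
      2 * ∑ q ∈ range s, #{z | (H.cell r y z ∧ H.sign r z x₀ = true) ∧
        H.sign q x z ≠ H.sign q z x} := by
  rw [← Finset.add_sum_erase _ _ (mem_range.2 hr), ← Finset.add_sum_erase _ _ (mem_range.2 hr)]
  have h0 : #{z | (H.cell r y z ∧ H.sign r z x₀ = true) ∧ H.sign r x' z ≠ H.sign r z x'} = 0 := by
    rw [Finset.card_eq_zero, Finset.filter_eq_empty_iff]
    rintro z - ⟨⟨h1, h2⟩, h3⟩
    rw [← H.sign_congr_right r hr _ _ _ h1, hxy', ← H.sign_congr_right r hr _ _ _ hx', h2] at h3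
    exact h3 rfl
  have h1 : #{z | (H.cell r y z ∧ H.sign r z x₀ = true) ∧ H.sign r x z ≠ H.sign r z x} =
      #{z | H.cell r y z ∧ H.sign r z x₀ = true} := by
    congr 1
    refine Finset.filter_congr fun z _ => ⟨fun h => h.1, fun h => ⟨h, ?_⟩⟩
    rw [← H.sign_congr_right r hr _ _ _ h.1, hxy, ← H.sign_congr_right r hr _ _ _ hx, h.2]
    simp
  have h2 : ∀ q ∈ (range s).erase r,
      #{z | (H.cell r y z ∧ H.sign r z x₀ = true) ∧ H.sign q x' z ≠ H.sign q z x'} =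
        #{z | (H.cell r y z ∧ H.sign r z x₀ = true) ∧ H.sign q x z ≠ H.sign q z x} := by
    intro q hq
    rw [mem_erase, mem_range] at hq
    rcases lt_or_gt_of_ne hq.1 with hqr | hqr
    · have hc : H.cell r x x' := (H.cell r).trans ((H.cell r).symm hx) hx'
      congr 1
      refine Finset.filter_congr fun z _ => ?_
      rw [H.sign_congr_left q hq.2 x x' z (H.cell_anti hqr hc),
        H.sign_congr_right q hq.2 z x x' (H.cell_anti hqr.le hc)]
    · have := H.two_mul_card_sign_ne hqr hq.2 x₀ x y
      have := H.two_mul_card_sign_ne hqr hq.2 x₀ x' y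
      omega
  rw [Finset.sum_congr rfl h2, h0, h1, ← H.two_mul_card_sign hr x₀ y]
  ring

open Classical in
/-- The graph of a hierarchy is layered by its partitions. -/
noncomputable def layeredGraph (H : Hierarchy V s) [NeZero s] {W : Type*} [Fintype W]
    (e : W ≃ V × ZMod s) : LayeredGraph (H.graph e) s where
  cell r := (H.cell r).comap fun w => (e w).1
  sign r x y := H.sign r (e x).1 (e y).1
  size r := H.size r * s
  cell_zero := by rw [H.cell_zero]; rfl
  card_cell r x := by
    rw [← H.card_cell r (e x).1]
    exact card_filter_equiv_fst e fun v => H.cell r (e x).1 v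
  sign_congr_left r hr x x' y h := H.sign_congr_left r hr _ _ _ h
  separated r hr x x' h h' := by
    have h1 := H.separated r hr _ _ h h'
    have h2 := card_filter_equiv_fst e fun v => H.sign r (e x).1 v ≠ H.sign r (e x').1 v
    have h3 : Fintype.card W = Fintype.card V * s := by
      rw [Fintype.card_congr e, Fintype.card_prod, ZMod.card]
    rw [h3]
    refine (Nat.mul_le_mul_right s h1).trans (le_of_eq ?_)
    rw [mul_assoc]
    congr 1
    convert h2.symm
  degree_gap r hr x₀ x x' y hx hx' hxy hxy' := by
    have key : ∀ x : W, #{z : W | ((H.cell r).comap (fun w => (e w).1) y z ∧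
        H.sign r (e z).1 (e x₀).1 = true) ∧ (H.graph e).Adj x z} =
        ∑ q ∈ range s, #{z | (H.cell r (e y).1 z ∧ H.sign r z (e x₀).1 = true) ∧
          H.sign q (e x).1 z ≠ H.sign q z (e x).1} := by
      intro x
      convert (card_filter_equiv e fun p => (H.cell r (e y).1 p.1 ∧
        H.sign r p.1 (e x₀).1 = true) ∧ H.sign ((e x).2 + p.2).val (e x).1 p.1 ≠
          H.sign ((e x).2 + p.2).val p.1 (e x).1).trans
        (card_filter_add_val (e x).2 fun q z => (H.cell r (e y).1 z ∧
          H.sign r z (e x₀).1 = true) ∧ H.sign q (e x).1 z ≠ H.sign q z (e x).1)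
      exact Iff.rfl
    rw [key, key]
    refine le_of_eq ?_
    linear_combination s * H.degree_gap hr hx hx' hxy hxy'

end Hierarchy

/-! ### Average degrees and regular pairs. -/

section MeanDegree

variable {W : Type*}

open Classical in
/-- The average number of neighbours in `B` of a vertex of `A`. -/
noncomputable def meanDeg (G : SimpleGraph W) (A B : Finset W) : ℝ :=
  (∑ x ∈ A, (#{y ∈ B | G.Adj x y} : ℝ)) / #A

theorem meanDeg_nonneg (G : SimpleGraph W) (A B : Finset W) : 0 ≤ meanDeg G A B := by
  unfold meanDeg; positivity

theorem meanDeg_le (G : SimpleGraph W) (A B : Finset W) : meanDeg G A B ≤ #B := by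
  classical
  refine div_le_of_le_mul₀ (by positivity) (by positivity) ?_
  rw [mul_comm, ← nsmul_eq_mul]
  exact Finset.sum_le_card_nsmul _ _ _ fun x _ => by exact_mod_cast card_filter_le _ _

open Classical in
theorem meanDeg_eq (G : SimpleGraph W) (A B : Finset W) :
    meanDeg G A B = G.edgeDensity A B * #B := by
  have h : ∑ x ∈ A, (#{y ∈ B | G.Adj x y} : ℝ) = #(G.interedges A B) := by
    rw [SimpleGraph.interedges, Rel.interedges, Finset.card_filter, Finset.sum_product]
    push_cast [Finset.card_filter]
    rfl
  rw [meanDeg, h, SimpleGraph.edgeDensity_def]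
  push_cast
  rcases B.eq_empty_or_nonempty with rfl | hB
  · simp [SimpleGraph.interedges, Rel.interedges]
  · have : (#B : ℝ) ≠ 0 := by exact_mod_cast hB.card_pos.ne'
    rw [div_mul_eq_mul_div, mul_div_mul_right _ _ this]

open Classical in
theorem meanDeg_add_le_of_forall_le {G : SimpleGraph W} {A A' B : Finset W} {g : ℝ}
    (hA : A.Nonempty) (hA' : A'.Nonempty)
    (h : ∀ x ∈ A, ∀ x' ∈ A', (#{y ∈ B | G.Adj x' y} : ℝ) + g ≤ #{y ∈ B | G.Adj x y}) :
    meanDeg G A' B + g ≤ meanDeg G A B := by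
  have hA0 : (0 : ℝ) < #A := by exact_mod_cast hA.card_pos
  have hA'0 : (0 : ℝ) < #A' := by exact_mod_cast hA'.card_pos
  unfold meanDeg
  rw [le_div_iff₀ hA0, mul_comm, ← nsmul_eq_mul]
  refine Finset.card_nsmul_le_sum _ _ _ fun x hx => ?_
  rw [← le_sub_iff_add_le, div_le_iff₀ hA'0, mul_comm, ← nsmul_eq_mul]
  exact Finset.sum_le_card_nsmul _ _ _ fun x' hx' => le_sub_iff_add_le.2 (h x hx x' hx')

/-- Scaling by |Z'| rather than |B| removes any lower bound on `B`: if `B` is too small for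
regularity to apply, the degree into it is below ε|Z'| anyway. -/
theorem IsRegularPair.meanDeg_sub_le {G : SimpleGraph W} {ε : ℝ} {Z Z' A A' B : Finset W}
    (h : IsRegularPair G ε Z Z') (hε : 0 < ε) (hA : A ⊆ Z) (hA' : A' ⊆ Z) (hB : B ⊆ Z')
    (hcA : ε * #Z ≤ #A) (hcA' : ε * #Z ≤ #A') :
    meanDeg G A B - meanDeg G A' B ≤ 2 * ε * #Z' := by
  classical
  have hBZ : (#B : ℝ) ≤ #Z' := by exact_mod_cast card_le_card hB
  rcases le_or_gt (ε * #Z') #B with hcB | hcB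
  · have h1 := abs_le.1 (h A hA B hB hcA hcB)
    have h2 := abs_le.1 (h A' hA' B hB hcA' hcB)
    rw [meanDeg_eq, meanDeg_eq, ← sub_mul]
    exact mul_le_mul (by linarith [h1.1, h2.2]) hBZ (by positivity) (by positivity)
  · have h1 := meanDeg_le G A B
    have h2 := meanDeg_nonneg G A' B
    have : 0 ≤ ε * #Z' := by positivity
    linarith

end MeanDegree

/-! ### Summation over the parts of a partition. -/

section Partition

variable {W : Type*} [Fintype W] [DecidableEq W]

theorem sum_card_filter_parts (P : Finpartition (univ : Finset W)) (q : W → Prop)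
    [DecidablePred q] :
    ∑ Z ∈ P.parts, #{z ∈ Z | q z} = #{z | q z} := by
  simp only [Finset.card_filter]
  have h := Finset.sum_biUnion (f := fun z => if q z then 1 else 0) P.supIndep.pairwiseDisjoint
  rw [← Finset.sup_eq_biUnion, P.sup_parts] at h
  exact h.symm

/-- Additivity in the second set is the reason for using average degrees instead of densities: a gap
into a part of the hierarchy distributes over the parts of `P`. -/
theorem sum_meanDeg_parts (G : SimpleGraph W) (P : Finpartition (univ : Finset W)) (A : Finset W)
    (q : W → Prop) [DecidablePred q] :
    ∑ Z ∈ P.parts, meanDeg G A {z ∈ Z | q z} = meanDeg G A {z | q z} := by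
  classical
  unfold meanDeg
  rw [← Finset.sum_div, Finset.sum_comm]
  congr 1
  refine Finset.sum_congr rfl fun x _ => ?_
  simp only [Finset.filter_filter]
  rw [← Nat.cast_sum, Nat.cast_inj]
  convert sum_card_filter_parts P fun z => q z ∧ G.Adj x z

/-- In an equipartition, a set of parts has at most twice its fair share of vertices. -/
theorem sum_card_mul_card_parts_le {P : Finpartition (univ : Finset W)} (hP : P.IsEquipartition)
    {S : Finset (Finset W)} (hS : S ⊆ P.parts) :
    (∑ Z ∈ S, #Z) * #P.parts ≤ 2 * #S * Fintype.card W := by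
  have h1 : ∀ Z ∈ S, #Z * #P.parts ≤ 2 * Fintype.card W := by
    intro Z hZ
    have h2 := hP.card_part_le_average_add_one (hS hZ)
    have h3 : #P.parts ≤ Fintype.card W := P.card_parts_le_card
    rw [Finset.card_univ] at h2
    calc #Z * #P.parts ≤ (Fintype.card W / #P.parts + 1) * #P.parts := by gcongr
      _ = Fintype.card W / #P.parts * #P.parts + #P.parts := by ring
      _ ≤ Fintype.card W + Fintype.card W := by
          gcongr; exact Nat.div_mul_le_self _ _
      _ = _ := by ring
  rw [Finset.sum_mul]
  refine (Finset.sum_le_card_nsmul _ _ _ h1).trans (le_of_eq ?_)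
  rw [smul_eq_mul]; ring

end Partition

/-! ### Spread-out sets are split by many signs. -/

open Classical in
/-- If a set `A` is not concentrated on one class of `R`, and distinct classes are separated by
many signs, then a positive proportion of the signs split `A` into two substantial pieces. -/
theorem card_le_card_splitting {W Y : Type*} [Fintype Y] (R : Setoid W) (σ : W → Y → Bool)
    (A : Finset W) {t : ℝ} (hσ : ∀ x x' y, R x x' → σ x y = σ x' y)
    (hsep : ∀ x ∈ A, ∀ x' ∈ A, ¬ R x x' → Fintype.card Y ≤ 4 * #{y | σ x y ≠ σ x' y})
    (hA : ∀ x ∈ A, 8 * t ≤ #{x' ∈ A | ¬ R x x'}) (hAt : 32 * t ≤ #A) (ht : 0 < t) :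
    (Fintype.card Y : ℝ) ≤
      8 * #{y | t ≤ #{x ∈ A | σ x y = false} ∧ t ≤ #{x ∈ A | σ x y = true}} := by
  set S : Finset Y := {y | t ≤ #{x ∈ A | σ x y = false} ∧ t ≤ #{x ∈ A | σ x y = true}} with hS
  set n : ℝ := (Fintype.card Y : ℝ) with hn
  have hn0 : 0 ≤ n := by positivity
  have hA0 : (0 : ℝ) < #A := by linarith
  have hsplit : ∀ y (b : Bool), (#{x ∈ A | σ x y ≠ b} : ℝ) + #{x ∈ A | ¬ σ x y ≠ b} = #A := by
    intro y b
    exact_mod_cast Finset.card_filter_add_card_filter_not (s := A) _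
  have hmem : ∀ y (b : Bool), t ≤ #{x ∈ A | σ x y ≠ b} → t ≤ #{x ∈ A | ¬ σ x y ≠ b} → y ∈ S := by
    intro y b h1 h2
    rw [hS, mem_filter]
    cases b <;> simp only [ne_eq, Bool.not_eq_false, Bool.not_eq_true] at h1 h2 <;>
      exact ⟨mem_univ _, by assumption, by assumption⟩
  have hsum : ∀ x ∈ A, n / 4 * #{x' ∈ A | ¬ R x x'} ≤ ∑ y, (#{x' ∈ A | σ x' y ≠ σ x y} : ℝ) := by
    intro x hx
    have h1 : ∑ y, (#{x' ∈ A | σ x' y ≠ σ x y} : ℝ) = ∑ x' ∈ A, (#{y | σ x' y ≠ σ x y} : ℝ) := by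
      exact_mod_cast Finset.sum_card_bipartiteAbove_eq_sum_card_bipartiteBelow
        (s := univ) (t := A) (fun y x' => σ x' y ≠ σ x y)
    rw [h1]
    calc n / 4 * #{x' ∈ A | ¬ R x x'} = ∑ x' ∈ A with ¬ R x x', n / 4 := by
          rw [Finset.sum_const, nsmul_eq_mul, mul_comm]
      _ ≤ ∑ x' ∈ A with ¬ R x x', (#{y | σ x' y ≠ σ x y} : ℝ) := by
          refine Finset.sum_le_sum fun x' hx' => ?_
          rw [mem_filter] at hx'
          have h2 := hsep x' hx'.1 x hx fun h => hx'.2 (R.symm h)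
          have h3 : n ≤ 4 * #{y | σ x' y ≠ σ x y} := by rw [hn]; exact_mod_cast h2
          linarith
      _ ≤ _ := Finset.sum_le_sum_of_subset_of_nonneg (filter_subset _ _)
          fun _ _ _ => by positivity
  have hS_sum : ∀ (f : Y → ℝ) (a b : ℝ), (∀ y ∈ S, f y ≤ a) → (∀ y ∉ S, f y ≤ b) → 0 ≤ b →
      ∑ y, f y ≤ #S * a + n * b := by
    intro f a b ha hb hb0
    rw [← Finset.sum_add_sum_compl S f]
    gcongr
    · rw [← nsmul_eq_mul]
      exact Finset.sum_le_card_nsmul _ _ _ ha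
    · refine (Finset.sum_le_card_nsmul _ _ b fun y hy => hb y (mem_compl.1 hy)).trans ?_
      rw [nsmul_eq_mul]
      gcongr
      rw [hn]
      exact_mod_cast card_le_univ _
  have hN : ∀ x y, (#{x' ∈ A | σ x' y ≠ σ x y} : ℝ) ≤ #{x' ∈ A | ¬ R x x'} := by
    intro x y
    have : #{x' ∈ A | σ x' y ≠ σ x y} ≤ #{x' ∈ A | ¬ R x x'} :=
      card_le_card fun x' hx' => by
        rw [mem_filter] at hx' ⊢
        exact ⟨hx'.1, fun h => hx'.2 (hσ _ _ y h).symm⟩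
    exact_mod_cast this
  -- If the class of some `x` fills half of `A`, compare signs with `x` only: a non-splitting `y`
  -- has at most t disagreements, at most an eighth of the number of vertices outside the class.
  by_cases hbig : ∃ x ∈ A, 2 * (#{x' ∈ A | ¬ R x x'} : ℝ) ≤ #A
  · obtain ⟨x, hx, hxA⟩ := hbig
    have h1 := hS_sum (fun y => (#{x' ∈ A | σ x' y ≠ σ x y} : ℝ)) #{x' ∈ A | ¬ R x x'} t
      (fun y _ => hN x y) (fun y hy => by
        by_contra! h
        refine hy (hmem y (σ x y) h.le ?_)
        linarith [hsplit y (σ x y), hN x y]) ht.le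
    have h2 := hsum x hx
    have h3 := hA x hx
    set q : ℝ := (#{x' ∈ A | ¬ R x x'} : ℝ)
    have hq : 0 < q := by linarith
    have h4 : n * (8 * t) ≤ n * q := by gcongr
    refine le_of_mul_le_mul_right (a := q) ?_ hq
    linarith
  -- Otherwise count ordered pairs in `A` with different signs: a splitting `y` gives at most
  -- |A|²/2, any other at most 2t|A| ≤ |A|²/16, and the average is at least |A|²/8.
  · push Not at hbig
    have h1 : ∑ y, ∑ x ∈ A, (#{x' ∈ A | σ x' y ≠ σ x y} : ℝ) ≤
        #S * (#A * #A / 2) + n * (2 * t * #A) := by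
      have hsq : ∀ y, ∑ x ∈ A, (#{x' ∈ A | σ x' y ≠ σ x y} : ℝ) =
          2 * #{x ∈ A | σ x y = false} * #{x ∈ A | σ x y = true} := by
        intro y
        rw [← Finset.sum_filter_add_sum_filter_not A (fun x => σ x y = false)]
        rw [Finset.sum_congr rfl (g := fun _ => (#{x ∈ A | σ x y = true} : ℝ)),
          Finset.sum_congr (s₁ := {x ∈ A | ¬ σ x y = false}) rfl
            (g := fun _ => (#{x ∈ A | σ x y = false} : ℝ)),
          Finset.sum_const, Finset.sum_const, nsmul_eq_mul, nsmul_eq_mul]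
        · simp only [Bool.not_eq_false]
          ring
        · intro x hx
          rw [mem_filter, Bool.not_eq_false] at hx
          simp [hx.2]
        · intro x hx
          rw [mem_filter] at hx
          simp [hx.2]
      have hadd : ∀ y, (#{x ∈ A | σ x y = false} : ℝ) + #{x ∈ A | σ x y = true} = #A := by
        intro y
        simpa using hsplit y true
      refine hS_sum _ _ _ (fun y _ => ?_) (fun y hy => ?_) (by positivity)
      · rw [hsq, ← hadd y]
        nlinarith [sq_nonneg ((#{x ∈ A | σ x y = false} : ℝ) - #{x ∈ A | σ x y = true})]
      · rw [hsq]
        have h5 := hadd y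
        have h6 : ¬ (t ≤ #{x ∈ A | σ x y = false} ∧ t ≤ #{x ∈ A | σ x y = true}) :=
          fun h => hy (by rw [hS, mem_filter]; exact ⟨mem_univ _, h⟩)
        have hf : (0 : ℝ) ≤ #{x ∈ A | σ x y = false} := by positivity
        have htr : (0 : ℝ) ≤ #{x ∈ A | σ x y = true} := by positivity
        rcases not_and_or.1 h6 with h7 | h7 <;> push Not at h7 <;> nlinarith
    have h2 : n / 4 * (#A * (#A / 2)) ≤ ∑ y, ∑ x ∈ A, (#{x' ∈ A | σ x' y ≠ σ x y} : ℝ) := by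
      rw [Finset.sum_comm]
      calc n / 4 * (#A * (#A / 2)) = ∑ x ∈ A, n / 4 * (#A / 2) := by
            rw [Finset.sum_const, nsmul_eq_mul]; ring
        _ ≤ _ := Finset.sum_le_sum fun x hx => le_trans
            (mul_le_mul_of_nonneg_left (by linarith [hbig x hx]) (by positivity)) (hsum x hx)
    have h3 : n * (#A * (32 * t)) ≤ n * (#A * #A) := by gcongr
    refine le_of_mul_le_mul_right (a := (#A * #A : ℝ)) ?_ (by positivity)
    linarith

/-! ### Passing from level `r` to level `r + 1`. -/

namespace LayeredGraph

variable {W : Type*} [Fintype W] {G : SimpleGraph W} {s : ℕ}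

open Classical in
/-- `Z` lies in one part of level `r`, up to a proportion `β`. -/
def Inside (L : LayeredGraph G s) (r : ℕ) (β : ℝ) (Z : Finset W) : Prop :=
  ∃ x, (#{z ∈ Z | ¬ L.cell r x z} : ℝ) ≤ β * #Z

open Classical in
theorem card_cell_left (L : LayeredGraph G s) (r : ℕ) (x : W) :
    #{z | L.cell r z x} = L.size r := by
  rw [← L.card_cell r x]
  congr 1
  exact Finset.filter_congr fun z _ => ⟨(L.cell r).symm, (L.cell r).symm⟩

-- Sums over parts of level `r` are taken over their vertices `y`, so each part is counted `L.size
-- r` times.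
open Classical in
theorem sum_card_cell_inter (L : LayeredGraph G s) (r : ℕ) (Z : Finset W) :
    ∑ y, #{z ∈ Z | L.cell r y z} = L.size r * #Z := by
  have h := Finset.sum_card_bipartiteAbove_eq_sum_card_bipartiteBelow
    (s := (univ : Finset W)) (t := Z) fun y z => L.cell r y z
  unfold Finset.bipartiteAbove Finset.bipartiteBelow at h
  rw [h, Finset.sum_congr rfl fun z _ => L.card_cell_left r z, Finset.sum_const, smul_eq_mul, mul_comm]

open Classical in
/-- The proportion of `Z'` outside its main part, and the regularity of `(Z, Z')` inside that part,
bound the total degree difference into `Z'`. -/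
theorem sum_meanDeg_sub_le (L : LayeredGraph G s) {r : ℕ} {ε β : ℝ} {Z Z' : Finset W}
    (hε : 0 < ε) (hreg : IsRegularPair G ε Z Z') (hin : L.Inside r β Z') {Y : Finset W}
    {A A' B : W → Finset W} (hA : ∀ y ∈ Y, A y ⊆ Z) (hA' : ∀ y ∈ Y, A' y ⊆ Z)
    (hcA : ∀ y ∈ Y, ε * #Z ≤ #(A y)) (hcA' : ∀ y ∈ Y, ε * #Z ≤ #(A' y))
    (hB : ∀ y ∈ Y, B y ⊆ {z ∈ Z' | L.cell r y z}) :
    ∑ y ∈ Y, (meanDeg G (A y) (B y) - meanDeg G (A' y) (B y)) ≤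
      (β + 2 * ε) * (L.size r * #Z') := by
  obtain ⟨x, hx⟩ := hin
  -- Regularity handles the at most `L.size r` vertices `y` in the main part of `Z'`; the other `y`
  -- see only the exceptional proportion β of `Z'`.
  rw [← Finset.sum_filter_add_sum_filter_not Y (fun y => L.cell r x y)]
  have h1 : ∑ y ∈ Y with L.cell r x y, (meanDeg G (A y) (B y) - meanDeg G (A' y) (B y)) ≤
      2 * ε * (L.size r * #Z') := by
    have hle : ∀ y ∈ ({y ∈ Y | L.cell r x y} : Finset W),
        meanDeg G (A y) (B y) - meanDeg G (A' y) (B y) ≤ 2 * ε * #Z' := by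
      intro y hy
      have hy := (mem_filter.1 hy).1
      exact hreg.meanDeg_sub_le hε (hA y hy) (hA' y hy)
        ((hB y hy).trans (filter_subset _ _)) (hcA y hy) (hcA' y hy)
    refine (Finset.sum_le_card_nsmul _ _ _ hle).trans ?_
    have hcard : #{y ∈ Y | L.cell r x y} ≤ L.size r := by
      rw [← L.card_cell r x]
      exact card_le_card (filter_subset_filter _ (subset_univ _))
    have hcard : (#{y ∈ Y | L.cell r x y} : ℝ) ≤ L.size r := by exact_mod_cast hcard
    rw [nsmul_eq_mul]
    calc _ ≤ (L.size r : ℝ) * (2 * ε * #Z') := by gcongr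
      _ = _ := by ring
  have h2 : ∑ y ∈ Y with ¬ L.cell r x y, (meanDeg G (A y) (B y) - meanDeg G (A' y) (B y)) ≤
      β * (L.size r * #Z') := by
    calc _ ≤ ∑ y ∈ Y with ¬ L.cell r x y,
          (#{z ∈ {z ∈ Z' | ¬ L.cell r x z} | L.cell r y z} : ℝ) := by
          refine Finset.sum_le_sum fun y hy => ?_
          rw [mem_filter] at hy
          have h3 := meanDeg_le G (A y) (B y)
          have h4 := meanDeg_nonneg G (A' y) (B y)
          have h5 : #(B y) ≤ #{z ∈ {z ∈ Z' | ¬ L.cell r x z} | L.cell r y z} := by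
            refine card_le_card fun z hz => ?_
            have hz := mem_filter.1 (hB y hy.1 hz)
            simp only [mem_filter]
            exact ⟨⟨hz.1, fun h => hy.2 ((L.cell r).trans h ((L.cell r).symm hz.2))⟩, hz.2⟩
          have h5 : (#(B y) : ℝ) ≤ #{z ∈ {z ∈ Z' | ¬ L.cell r x z} | L.cell r y z} := by
            exact_mod_cast h5
          linarith
      _ ≤ ∑ y, (#{z ∈ {z ∈ Z' | ¬ L.cell r x z} | L.cell r y z} : ℝ) :=
          Finset.sum_le_sum_of_subset_of_nonneg (subset_univ _) fun _ _ _ => by positivity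
      _ = L.size r * #{z ∈ Z' | ¬ L.cell r x z} := by
          exact_mod_cast L.sum_card_cell_inter r {z ∈ Z' | ¬ L.cell r x z}
      _ ≤ L.size r * (β * #Z') := by gcongr
      _ = _ := by ring
  linarith

open Classical in
/-- The trivial bound on the total degree difference into `Z'`. -/
theorem sum_meanDeg_sub_le_card (L : LayeredGraph G s) {r : ℕ} {Z' : Finset W} {Y : Finset W}
    {A A' B : W → Finset W} (hB : ∀ y ∈ Y, B y ⊆ {z ∈ Z' | L.cell r y z}) :
    ∑ y ∈ Y, (meanDeg G (A y) (B y) - meanDeg G (A' y) (B y)) ≤ L.size r * #Z' := by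
  calc _ ≤ ∑ y ∈ Y, (#{z ∈ Z' | L.cell r y z} : ℝ) := by
        refine Finset.sum_le_sum fun y hy => ?_
        have h3 := meanDeg_le G (A y) (B y)
        have h4 := meanDeg_nonneg G (A' y) (B y)
        have h5 : (#(B y) : ℝ) ≤ #{z ∈ Z' | L.cell r y z} := by
          exact_mod_cast card_le_card (hB y hy)
        linarith
    _ ≤ ∑ y, (#{z ∈ Z' | L.cell r y z} : ℝ) :=
        Finset.sum_le_sum_of_subset_of_nonneg (subset_univ _) fun _ _ _ => by positivity
    _ = _ := by exact_mod_cast L.sum_card_cell_inter r Z'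

open Classical in
/-- A part that lies almost in one part of level `r`, and is regular with most others which do so
too, lies almost in one part of level `r + 1`. -/
theorem inside_succ [DecidableEq W] (L : LayeredGraph G s) {r : ℕ} (hr : r < s) {ε β μ : ℝ}
    (hε : 0 < ε) (hε64 : ε ≤ 1 / 64) (hβ : β ≤ 1 / 2) {P : Finpartition (univ : Finset W)}
    {Z : Finset W} (hZ : Z.Nonempty) (hin : L.Inside r β Z) {N : Finset (Finset W)}
    (hNP : N ⊆ P.parts) (hNin : ∀ Z' ∈ N, L.Inside r β Z')
    (hNreg : ∀ Z' ∈ N, IsRegularPair G ε Z Z') (hβ0 : 0 ≤ β)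
    (hmass : ∑ Z' ∈ P.parts \ N, (#Z' : ℝ) ≤ μ * Fintype.card W)
    (hsmall : 16 * s * (β + 2 * ε + μ) < 1) : L.Inside (r + 1) (β + 8 * ε) Z := by
  by_contra hnot
  obtain ⟨x₀, hx₀⟩ := hin
  unfold Inside at hnot
  push Not at hnot
  have hZ0 : (0 : ℝ) < #Z := by exact_mod_cast hZ.card_pos
  have hs0 : (0 : ℝ) < s := by exact_mod_cast (Nat.zero_le r).trans_lt hr
  have hn0 : (0 : ℝ) < Fintype.card W := by
    obtain ⟨z, _⟩ := hZ
    exact_mod_cast Fintype.card_pos_iff.2 ⟨z⟩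
  have hsize : (0 : ℝ) < L.size r := by
    rw [← L.card_cell r x₀]
    exact_mod_cast Finset.card_pos.2 ⟨x₀, by simp⟩
  set A : Finset W := {z ∈ Z | L.cell r x₀ z} with hAdef
  have hAcard : (#A : ℝ) + #{z ∈ Z | ¬ L.cell r x₀ z} = #Z := by
    exact_mod_cast Finset.card_filter_add_card_filter_not (s := Z) _
  have hAcell : ∀ x ∈ A, L.cell r x₀ x := fun x hx => (mem_filter.1 hx).2
  have hmany : ∀ x ∈ A, 8 * (ε * #Z) ≤ #{x' ∈ A | ¬ L.cell (r + 1) x x'} := by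
    intro x _
    have h1 : #{z ∈ Z | ¬ L.cell (r + 1) x z} ≤
        #{x' ∈ A | ¬ L.cell (r + 1) x x'} + #{z ∈ Z | ¬ L.cell r x₀ z} := by
      refine (card_le_card fun z hz => ?_).trans (card_union_le _ _)
      rw [mem_union, mem_filter, mem_filter, mem_filter]
      rw [mem_filter] at hz
      by_cases h : L.cell r x₀ z
      · exact Or.inl ⟨⟨hz.1, h⟩, hz.2⟩
      · exact Or.inr ⟨hz.1, h⟩
    have h1 : (#{z ∈ Z | ¬ L.cell (r + 1) x z} : ℝ) ≤
        #{x' ∈ A | ¬ L.cell (r + 1) x x'} + #{z ∈ Z | ¬ L.cell r x₀ z} := by exact_mod_cast h1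
    linarith [hnot x]
  -- Applied with t = ε|Z|: the 8t comes from the increment 8ε, and |A| ≥ |Z|/2 ≥ 32t from β ≤ 1/2
  -- and ε ≤ 1/64.
  have hcount := card_le_card_splitting (L.cell (r + 1)) (L.sign r) A
    (L.sign_congr_left r hr)
    (fun x hx x' hx' h => L.separated r hr x x'
      ((L.cell r).trans ((L.cell r).symm (hAcell x hx)) (hAcell x' hx')) h)
    hmany (by nlinarith) (by positivity : 0 < ε * #Z)
  set Y : Finset W := {y | ε * #Z ≤ #{x ∈ A | L.sign r x y = false} ∧
    ε * #Z ≤ #{x ∈ A | L.sign r x y = true}} with hY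
  set A₀ : W → Finset W := fun y => {x ∈ A | L.sign r x y = false}
  set A₁ : W → Finset W := fun y => {x ∈ A | L.sign r x y = true}
  have hgap : ∀ y ∈ Y, L.size r / (2 * s) ≤ ∑ Z' ∈ P.parts,
      (meanDeg G (A₀ y) {z ∈ Z' | L.cell r y z ∧ L.sign r z x₀ = true} -
        meanDeg G (A₁ y) {z ∈ Z' | L.cell r y z ∧ L.sign r z x₀ = true}) := by
    intro y hy
    rw [hY, mem_filter] at hy
    have hpos : 0 < ε * #Z := by positivity
    have hne : ∀ B : Finset W, ε * #Z ≤ #B → B.Nonempty := fun B hB =>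
      Finset.card_pos.1 (by exact_mod_cast hpos.trans_le hB)
    rw [Finset.sum_sub_distrib, sum_meanDeg_parts, sum_meanDeg_parts, le_sub_iff_add_le']
    refine meanDeg_add_le_of_forall_le (hne _ hy.2.1) (hne _ hy.2.2) fun x hx x' hx' => ?_
    rw [mem_filter] at hx hx'
    have h := L.degree_gap r hr x₀ x x' y (hAcell x hx.1) (hAcell x' hx'.1) hx.2 hx'.2
    rw [Finset.filter_filter, Finset.filter_filter]
    rw [← mul_le_mul_iff_right₀ (by positivity : (0 : ℝ) < 2 * s), mul_add,
      mul_div_cancel₀ _ (by positivity : (2 * s : ℝ) ≠ 0)]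
    exact_mod_cast h
  have hBsub : ∀ (Z' : Finset W), ∀ y ∈ Y, ({z ∈ Z' | L.cell r y z ∧ L.sign r z x₀ = true} :
      Finset W) ⊆ {z ∈ Z' | L.cell r y z} := fun Z' y _ z hz => by
    rw [mem_filter] at hz ⊢
    exact ⟨hz.1, hz.2.1⟩
  have hZsum : ∑ Z' ∈ P.parts, (#Z' : ℝ) = Fintype.card W := by
    exact_mod_cast P.sum_card_parts
  -- The gaps of all splitting `y` are summed and the sum is exchanged with that over parts. As `Y`
  -- has at least n/8 elements, this forces 1 ≤ 16s(β + 2ε + μ).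
  have hupper : #Y * (L.size r / (2 * s)) ≤
      (β + 2 * ε) * (L.size r * Fintype.card W) + L.size r * (μ * Fintype.card W) := by
    calc #Y * (L.size r / (2 * s)) = ∑ y ∈ Y, (L.size r / (2 * s) : ℝ) := by
          rw [Finset.sum_const, nsmul_eq_mul]
      _ ≤ _ := Finset.sum_le_sum hgap
      _ = _ := Finset.sum_comm
      _ = _ := (Finset.sum_sdiff hNP).symm
      _ ≤ ∑ Z' ∈ P.parts \ N, L.size r * (#Z' : ℝ) +
          ∑ Z' ∈ N, (β + 2 * ε) * (L.size r * (#Z' : ℝ)) := by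
          refine add_le_add (Finset.sum_le_sum fun Z' _ => ?_)
            (Finset.sum_le_sum fun Z' hZ' => ?_)
          · exact L.sum_meanDeg_sub_le_card (hBsub Z')
          · exact L.sum_meanDeg_sub_le hε (hNreg Z' hZ') (hNin Z' hZ')
              (fun y _ => (filter_subset _ _).trans (filter_subset _ _))
              (fun y _ => (filter_subset _ _).trans (filter_subset _ _))
              (fun y hy => (mem_filter.1 hy).2.1) (fun y hy => (mem_filter.1 hy).2.2) (hBsub Z')
      _ ≤ ∑ Z' ∈ P.parts \ N, L.size r * (#Z' : ℝ) +
          ∑ Z' ∈ P.parts, (β + 2 * ε) * (L.size r * (#Z' : ℝ)) := by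
          gcongr
      _ ≤ _ := by
          rw [← Finset.mul_sum, ← Finset.mul_sum, ← Finset.mul_sum, hZsum, add_comm]
          gcongr
  have h1 : Fintype.card W * (L.size r / (2 * s) : ℝ) ≤ 8 * #Y * (L.size r / (2 * s)) := by
    gcongr
  have h2 : (Fintype.card W * L.size r : ℝ) ≤
      16 * s * (β + 2 * ε + μ) * (Fintype.card W * L.size r) := by
    have h3 : (Fintype.card W * L.size r : ℝ) =
        2 * s * (Fintype.card W * (L.size r / (2 * s))) := by field_simp
    rw [h3]
    calc _ ≤ 2 * s * (8 * ((β + 2 * ε) * (L.size r * Fintype.card W) +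
          L.size r * (μ * Fintype.card W))) := by
          refine mul_le_mul_of_nonneg_left ?_ (by positivity)
          linarith
      _ = _ := by field_simp; ring
  have h4 : (0 : ℝ) < Fintype.card W * L.size r := by positivity
  nlinarith

end LayeredGraph

/-! ### Regular equipartitions almost refine the finest level. -/

open Classical in
/-- In a regular equipartition, few parts are irregular with many others. -/
theorem IsRegularEquipartition.card_irregular_le {W : Type*} [Fintype W] [DecidableEq W]
    {G : SimpleGraph W} {ε : ℝ} {P : Finpartition (univ : Finset W)}
    (h : IsRegularEquipartition G ε P) {η : ℝ} (hk : 0 < #P.parts) :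
    #{Z ∈ P.parts | η * #P.parts ≤ #{Z' ∈ P.parts | ¬ IsRegularPair G ε Z Z'}} * η ≤
      ε * #P.parts := by
  have hk0 : (0 : ℝ) < #P.parts := by exact_mod_cast hk
  have h1 : #(irregularPairs G ε P) =
      ∑ Z ∈ P.parts, #{Z' ∈ P.parts | ¬ IsRegularPair G ε Z Z'} := by
    simp only [irregularPairs, Finset.card_filter]
    rw [Finset.sum_product]
  have h2 := h.2
  rw [h1] at h2
  push_cast at h2
  refine le_of_mul_le_mul_right (a := (#P.parts : ℝ)) ?_ hk0
  rw [mul_assoc ε, ← sq]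
  refine le_trans ?_ h2
  rw [mul_assoc, ← nsmul_eq_mul]
  refine (Finset.card_nsmul_le_sum _ _ _ fun Z hZ => (mem_filter.1 hZ).2).trans ?_
  exact Finset.sum_le_sum_of_subset_of_nonneg (filter_subset _ _) fun _ _ _ => by positivity

open Classical in
/-- Every regular equipartition of a layered graph has order comparable to the number of parts of
the finest level. -/
theorem LayeredGraph.card_le_mul_card_parts {W : Type*} [Fintype W] [DecidableEq W] [Nonempty W]
    {G : SimpleGraph W} {s : ℕ} (L : LayeredGraph G s) (hs : 0 < s) {ε : ℝ} (hε : 0 < ε)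
    (hεs : ε * s ^ 2 ≤ 1 / 20000) {P : Finpartition (univ : Finset W)}
    (h : IsRegularEquipartition G ε P) : Fintype.card W ≤ 4 * L.size s * #P.parts := by
  have hs1 : (1 : ℝ) ≤ s := by exact_mod_cast hs
  have hs0 : (0 : ℝ) < s := by linarith
  have hεs1 : ε * s ≤ 1 / 20000 := by nlinarith [mul_pos hε hs0]
  have hε1 : ε ≤ 1 / 20000 := by nlinarith
  have hk : 0 < #P.parts :=
    Finset.card_pos.2 (P.parts_nonempty (univ_nonempty.ne_empty))
  have hk0 : (0 : ℝ) < #P.parts := by exact_mod_cast hk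
  have hn0 : (0 : ℝ) < Fintype.card W := by exact_mod_cast Fintype.card_pos
  set n : ℝ := (Fintype.card W : ℝ) with hn
  -- The irregular partners of a part outside `D` have mass at most 2ηn, contributing 32ηs = 1/8 to
  -- the budget of `inside_succ`; the price is |D| ≤ 256εs·k, where k is the order of `P`.
  set η : ℝ := 1 / (256 * s) with hη
  have hηs : η * s = 1 / 256 := by rw [hη]; field_simp
  have hη0 : 0 < η := by positivity
  set D : Finset (Finset W) :=
    {Z ∈ P.parts | η * #P.parts ≤ #{Z' ∈ P.parts | ¬ IsRegularPair G ε Z Z'}} with hD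
  have hDcard : (#D : ℝ) ≤ 256 * (ε * s) * #P.parts := by
    have h1 := h.card_irregular_le (η := η) hk
    rw [← hD] at h1
    have h2 : #D * η * (256 * s) ≤ ε * #P.parts * (256 * s) := by gcongr
    have h3 : #D * η * (256 * s) = #D := by
      rw [mul_assoc, hη]; field_simp
    linarith
  have hmass : ∀ S ⊆ P.parts, ∀ a : ℝ, (#S : ℝ) ≤ a * #P.parts →
      ∑ Z ∈ S, (#Z : ℝ) ≤ 2 * a * n := by
    intro S hS a ha
    have h1 : (∑ Z ∈ S, (#Z : ℝ)) * #P.parts ≤ 2 * #S * n := by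
      rw [hn]; exact_mod_cast sum_card_mul_card_parts_le h.1 hS
    refine le_of_mul_le_mul_right (a := (#P.parts : ℝ)) (h1.trans ?_) hk0
    calc 2 * #S * n ≤ 2 * (a * #P.parts) * n := by gcongr
      _ = _ := by ring
  have hDP : D ⊆ P.parts := filter_subset _ _
  have hDmass := hmass D hDP _ hDcard
  have hDirr : ∀ Z ∈ P.parts \ D,
      (#{Z' ∈ P.parts | ¬ IsRegularPair G ε Z Z'} : ℝ) ≤ η * #P.parts := by
    intro Z hZ
    by_contra! hlt
    exact (mem_sdiff.1 hZ).2 (by rw [hD, mem_filter]; exact ⟨(mem_sdiff.1 hZ).1, hlt.le⟩)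
  clear_value D
  have hin : ∀ r ≤ s, ∀ Z ∈ P.parts \ D, L.Inside r (8 * ε * r) Z := by
    intro r
    induction r with
    | zero =>
      intro _ Z _
      refine ⟨Classical.arbitrary W, ?_⟩
      have h0 : ∀ x y, L.cell 0 x y := fun x y => by rw [L.cell_zero]; trivial
      simp [h0]
    | succ r ih =>
      intro hr Z hZ
      have hZP := mem_sdiff.1 hZ
      have hrs : (r : ℝ) ≤ s := by exact_mod_cast (Nat.le_of_succ_le hr)
      have hβ : 8 * ε * r ≤ 8 * (ε * s) := by
        rw [mul_assoc]; gcongr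
      have hirrmass := hmass _ (filter_subset _ _) _ (hDirr Z hZ)
      have hN : ∑ Z' ∈ P.parts \ {Z' ∈ P.parts \ D | IsRegularPair G ε Z Z'}, (#Z' : ℝ) ≤
          (2 * (256 * (ε * s)) + 2 * η) * n := by
        calc _ ≤ ∑ Z' ∈ D ∪ {Z' ∈ P.parts | ¬ IsRegularPair G ε Z Z'}, (#Z' : ℝ) := by
              refine Finset.sum_le_sum_of_subset_of_nonneg (fun Z' hZ' => ?_)
                fun _ _ _ => by positivity
              rw [mem_sdiff, mem_filter, mem_sdiff] at hZ'
              rw [mem_union]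
              by_cases h1 : Z' ∈ D
              · exact Or.inl h1
              · exact Or.inr (mem_filter.2 ⟨hZ'.1, fun h2 => hZ'.2 ⟨⟨hZ'.1, h1⟩, h2⟩⟩)
          _ ≤ ∑ Z' ∈ D, (#Z' : ℝ) +
              ∑ Z' ∈ P.parts with ¬ IsRegularPair G ε Z Z', (#Z' : ℝ) := by
              rw [← Finset.sum_union_inter]
              exact le_add_of_nonneg_right (Finset.sum_nonneg fun _ _ => Nat.cast_nonneg _)
          _ ≤ _ := by linarith
      have h1 := L.inside_succ (P := P) (r := r) hr hε (by linarith) (β := 8 * ε * r)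
        (by linarith) (P.nonempty_of_mem_parts hZP.1) (ih (by omega) Z hZ)
        ((filter_subset _ _).trans sdiff_subset)
        (fun Z' hZ' => ih (by omega) Z' (mem_filter.1 hZ').1)
        (fun Z' hZ' => (mem_filter.1 hZ').2) (by positivity) hN ?_
      · convert h1 using 1
        push_cast
        ring
      -- The dominant term 16s · 512εs, due to the mass of `D`, is what requires ε s² to be small.
      · calc 16 * s * (8 * ε * r + 2 * ε + (2 * (256 * (ε * s)) + 2 * η))
            ≤ 16 * s * (8 * (ε * s) + 2 * ε + (2 * (256 * (ε * s)) + 2 * η)) := by gcongr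
          _ = 8320 * (ε * s ^ 2) + 32 * (ε * s) + 32 * (η * s) := by ring
          _ < 1 := by rw [hηs]; linarith
  have hfinal : ∀ Z ∈ P.parts \ D, (#Z : ℝ) ≤ 2 * L.size s := by
    intro Z hZ
    obtain ⟨x, hx⟩ := hin s le_rfl Z hZ
    have h1 : (#{z ∈ Z | L.cell s x z} : ℝ) + #{z ∈ Z | ¬ L.cell s x z} = #Z := by
      exact_mod_cast Finset.card_filter_add_card_filter_not (s := Z) _
    have h2 : (#{z ∈ Z | L.cell s x z} : ℝ) ≤ L.size s := by
      rw [← L.card_cell s x]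
      exact_mod_cast card_le_card (filter_subset_filter _ (subset_univ _))
    have h3 : 8 * ε * s * #Z ≤ 1 / 2 * #Z := by
      gcongr
      linarith
    linarith
  have htotal : ∑ Z ∈ P.parts \ D, (#Z : ℝ) + ∑ Z ∈ D, (#Z : ℝ) = n := by
    rw [Finset.sum_sdiff hDP, hn, ← Finset.card_univ, ← P.sum_card_parts]
    push_cast
    rfl
  have hupper : ∑ Z ∈ P.parts \ D, (#Z : ℝ) ≤ #P.parts * (2 * L.size s) := by
    calc _ ≤ #(P.parts \ D) • (2 * L.size s : ℝ) := Finset.sum_le_card_nsmul _ _ _ hfinal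
      _ ≤ _ := by
        rw [nsmul_eq_mul]
        gcongr
        exact sdiff_subset
  -- The mass of `D` is at most 512εs·n < n/2, so the remaining parts cover at least half of the
  -- vertices.
  have hres : n ≤ 4 * L.size s * #P.parts := by nlinarith
  rw [hn] at hres
  exact_mod_cast hres

/-! ### Choice of parameters. -/

/-- A graph all of whose regular equipartitions have tower order. -/
theorem exists_graph_tower_le (h : ℕ) {ε : ℝ} (hε : 0 < ε)
    (hεh : ε * ((h + 3 : ℕ) : ℝ) ^ 2 ≤ 1 / 20000) :
    ∃ (n : ℕ) (G : SimpleGraph (Fin n)), ∀ P : Finpartition (univ : Finset (Fin n)),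
      IsRegularEquipartition G ε P → tower h ≤ #P.parts := by
  obtain ⟨V, _, H, hV, hT⟩ := Hierarchy.exists_large (h + 3)
  have hVpos : 0 < Fintype.card V := lt_of_lt_of_le (by positivity) hV
  let e := (Fintype.equivFin (V × ZMod (h + 3))).symm
  have hcard : Fintype.card (Fin (Fintype.card (V × ZMod (h + 3)))) =
      Fintype.card V * (h + 3) := by
    rw [Fintype.card_fin, Fintype.card_prod, ZMod.card]
  refine ⟨_, H.graph e, fun P hP => ?_⟩
  have : Nonempty (Fin (Fintype.card (V × ZMod (h + 3)))) := by
    rw [← Fintype.card_pos_iff, hcard]; positivity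
  have h1 := (H.layeredGraph e).card_le_mul_card_parts (by omega) hε hεh hP
  have h2 : (H.layeredGraph e).size (h + 3) = h + 3 := by
    classical
    obtain ⟨v⟩ := Fintype.card_pos_iff.1 hVpos
    have h3 : H.size (h + 3) = 1 := by
      rw [← H.card_cell (h + 3) v, Finset.card_eq_one]
      refine ⟨v, ?_⟩
      ext y
      rw [mem_filter, mem_singleton, H.cell_last]
      exact ⟨fun hy => hy.2.symm, fun hy => ⟨mem_univ _, hy.symm⟩⟩
    change H.size (h + 3) * (h + 3) = h + 3
    rw [h3, one_mul]
  rw [h2, hcard] at h1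
  have h4 : Fintype.card V ≤ 4 * #P.parts := by
    refine Nat.le_of_mul_le_mul_right (h1.trans (le_of_eq ?_)) (by omega : 0 < h + 3)
    ring
  have := hT h le_rfl
  omega

end TowerBound

theorem mainTheorem2 :
    ∃ c : ℝ, 0 < c ∧ ∀ ε : ℝ, 0 < ε → ε < c →
      (∃ (n : ℕ) (G : SimpleGraph (Fin n)),
        ∀ P : Finpartition (Finset.univ : Finset (Fin n)),
          TowerBound.IsRegularEquipartition G ε P →
            TowerBound.twr (c / ε ^ (1 / 6 : ℝ)) ≤ P.parts.card) ∧
      (∀ M : ℕ, TowerBound.IsRegularityBound ε M →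
        TowerBound.twr (c / ε ^ (1 / 6 : ℝ)) ≤ M) := by
  -- A sixth power, so that ε < c gives u = ε^(1/6) < 1/100. Then u(T + 3) ≤ 1 for the height T, and
  -- the spare factor u⁴ brings ε(T + 3)² below 1/20000.
  refine ⟨(1 / 100) ^ 6, by norm_num, fun ε hε hεc => ?_⟩
  have hgraph : ∃ (n : ℕ) (G : SimpleGraph (Fin n)),
      ∀ P : Finpartition (Finset.univ : Finset (Fin n)),
        TowerBound.IsRegularEquipartition G ε P →
          TowerBound.twr ((1 / 100) ^ 6 / ε ^ (1 / 6 : ℝ)) ≤ P.parts.card := by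
    refine TowerBound.exists_graph_tower_le _ hε ?_
    set u : ℝ := ε ^ (1 / 6 : ℝ) with hu
    have hu0 : 0 < u := Real.rpow_pos_of_pos hε _
    have hu6 : u ^ 6 = ε := by
      rw [hu, ← Real.rpow_natCast, ← Real.rpow_mul hε.le]
      norm_num
    have hu1 : u < 1 / 100 := by
      rw [← hu6] at hεc
      exact lt_of_pow_lt_pow_left₀ 6 (by norm_num) hεc
    have hceil := Nat.ceil_lt_add_one (a := (1 / 100 : ℝ) ^ 6 / u) (by positivity)
    set T := ⌈(1 / 100 : ℝ) ^ 6 / u⌉₊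
    have hTu : u * ((T + 3 : ℕ) : ℝ) ≤ 1 := by
      have h1 : u * T ≤ u * ((1 / 100 : ℝ) ^ 6 / u + 1) := by gcongr
      have h2 : u * ((1 / 100 : ℝ) ^ 6 / u + 1) = (1 / 100 : ℝ) ^ 6 + u := by field_simp
      push_cast
      linarith
    calc ε * ((T + 3 : ℕ) : ℝ) ^ 2 = u ^ 4 * (u * ((T + 3 : ℕ) : ℝ)) ^ 2 := by
          rw [← hu6]; ring
      _ ≤ (1 / 100) ^ 4 * 1 ^ 2 := by gcongr
      _ ≤ 1 / 20000 := by norm_num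
  refine ⟨hgraph, fun M hM => ?_⟩
  obtain ⟨n, G, hG⟩ := hgraph
  obtain ⟨P, hP, hPM⟩ := hM n G
  exact (hG P hP).trans hPM
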